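/- Let $G=(V,E)$ be a finite simple graph with $n=|V|$ vertices, one qubit sitting at each vertex. Let $U=U^{(1)}\cdots U^{(L)}$ be a quantum circuit of depth $L$ on $G$: each layer $U^{(\ell)}$ is a tensor product of unitary gates with pairwise disjoint supports (and of the identity on the idle qubits), each gate acting on a single qubit or on the two endpoints of an edge of $G$. Put $|\psi\rangle=U|0\rangle^{\otimes n}$. For $i\in V$ let $Z_i$ and $a_i$ be the operators that act on qubit $i$ as $Z=|0\rangle\langle 0|-|1\rangle\langle 1|$ and $|0\rangle\langle 1|$, respectively, and as the identity on the other qubits. For $\epsilon>0$ set $$\beta_\epsilon=\log(1/\epsilon),\qquad H_U=-\sum_{i\in V}UZ_iU^\dagger,\qquad \sigma(U)=\frac{e^{-\beta_\epsilon H_U}}{\operatorname{tr} e^{-\beta_\epsilon H_U}} .$$ For states $\rho,\sigma$ let $D(\rho\|\sigma)=\operatorname{tr}\rho(\log\rho-\log\sigma)$ (natural logarithm, $0\log 0=0$) be the relative entropy if the support of $\rho$ is contained in that of $\sigma$, and $D(\rho\|\sigma)=+\infty$ otherwise. Then for every $n$-qubit state (density matrix) $\rho$ and every observable (self-adjoint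 operator) $O$, $D(\rho\|\sigma(U))<\infty$ and $$\bigl|\operatorname{tr} O(|\psi\rangle\langle\psi|-\rho)\bigr|\le \|O\|_{\mathrm{Lip},\nabla}\Bigl(\sqrt{\epsilon n}+\sqrt{D(\rho\|\sigma(U))}\Bigr),$$ where $$\|O\|_{\mathrm{Lip},\nabla}^2=\sum_{i\in V}\Bigl(\bigl\|[O,Ua_iU^\dagger]\bigr\|^2+\bigl\|[O,Ua_i^\dagger U^\dagger]\bigr\|^2\Bigr)$$ and $\|\cdot\|$ is the operator norm. -/

import Mathlib

noncomputable section

open scoped ComplexOrder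

namespace QubitCircuit

variable {V : Type*} [Fintype V] [DecidableEq V]

/-- The computational basis of the qubits sitting at the points of `V`: bit strings. -/
abbrev Bits (V : Type*) : Type _ := V → Fin 2

/-- Operators on `(ℂ²)^{⊗ V}`, as matrices in the computational basis. -/
abbrev Op (V : Type*) : Type _ := Matrix (Bits V) (Bits V) ℂ

/-- The operator `A ⊗ I` with `A` acting on the qubits in `s` and the identity elsewhere. -/
def extend (s : Finset V) (A : Matrix (s → Fin 2) (s → Fin 2) ℂ) : Op V :=
  Matrix.of fun x y =>
    if ∀ j, j ∉ s → x j = y j then A (fun j => x j) (fun j => y j) else 0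

/-- The one-qubit operator `A` acting on qubit `i`, and the identity elsewhere. -/
def onSite (i : V) (A : Matrix (Fin 2) (Fin 2) ℂ) : Op V :=
  Matrix.of fun x y => if ∀ j, j ≠ i → x j = y j then A (x i) (y i) else 0

/-- Pauli `Z` on qubit `i`. -/
def pauliZ (i : V) : Op V := onSite i !![1, 0; 0, -1]

/-- The annihilation operator `|0⟩⟨1|` on qubit `i`. -/
def annihilation (i : V) : Op V := onSite i !![0, 1; 0, 0]

/-- A gate laid out according to the graph `G`: a unitary acting on a single qubit or on the two
endpoints of an edge of `G`. -/
structure Gate (G : SimpleGraph V) where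
  support : Finset V
  isLocal : (∃ v, support = {v}) ∨ ∃ v w, G.Adj v w ∧ support = {v, w}
  unitary : Matrix.unitaryGroup (support → Fin 2) ℂ

/-- A layer: gates on pairwise disjoint supports, applied in parallel. -/
structure Layer (G : SimpleGraph V) where
  gates : List (Gate G)
  disjoint : gates.Pairwise fun g h => Disjoint g.support h.support

/-- The tensor product of the gates of a layer (and of the identity on the idle qubits). The
supports being disjoint, it is the product, in any order, of the extended gates. -/
def Layer.op {G : SimpleGraph V} (l : Layer G) : Op V :=
  (l.gates.map fun g => extend g.support g.unitary.1).prod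

/-- A circuit of depth `L` on the interaction graph `G`: a sequence of `L` layers. -/
abbrev Circuit (G : SimpleGraph V) (L : ℕ) : Type _ := Fin L → Layer G

/-- The operator implemented by a circuit: the product of its layers. -/
def Circuit.op {G : SimpleGraph V} {L : ℕ} (C : Circuit G L) : Op V :=
  (List.ofFn fun l => (C l).op).prod

/-- The basis vector `|0⟩^{⊗ V}`. -/
def ketZero (V : Type*) [DecidableEq (Bits V)] : Bits V → ℂ := Pi.single 0 1

/-- The rank-one operator `|ψ⟩⟨ψ|`. -/
def ketbra (ψ : Bits V → ℂ) : Op V := Matrix.vecMulVec ψ (star ψ)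

/-- `U A U†`. -/
def conj (U A : Op V) : Op V := U * A * U.conjTranspose

/-- Density matrices. -/
def IsState (ρ : Op V) : Prop := ρ.PosSemidef ∧ ρ.trace = 1

/-- The Hamiltonian `H_U = - ∑ i, U Z_i U†`. -/
def hamiltonian (U : Op V) : Op V := -∑ i, conj U (pauliZ i)

/-- The Gibbs state `e^{-β H} / tr e^{-β H}`. -/
def gibbs (β : ℝ) (H : Op V) : Op V :=
  (NormedSpace.exp (-(β : ℂ) • H)).trace⁻¹ • NormedSpace.exp (-(β : ℂ) • H)

open Classical in
/-- Umegaki's relative entropy `D(ρ‖σ) = tr ρ (log ρ - log σ)` (natural logarithm, by functional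
calculus, with `0 log 0 = 0`) if the support of `ρ` is contained in that of `σ`, that is, if
`ker σ ⊆ ker ρ`, and `+∞` otherwise. -/
def relEntropy (ρ σ : Op V) : EReal :=
  if ∀ v : Bits V → ℂ, σ.mulVec v = 0 → ρ.mulVec v = 0 then
    (((ρ * (cfc Real.log ρ - cfc Real.log σ)).trace.re : ℝ) : EReal)
  else ⊤

/-- The operator norm with respect to the Hilbert space norm of `(ℂ²)^{⊗ V}`. -/
def opNorm (A : Op V) : ℝ := ‖Matrix.toEuclideanCLM (n := Bits V) (𝕜 := ℂ) A‖

/-- The commutator `[A, B]`. -/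
def comm (A B : Op V) : Op V := A * B - B * A

/-- The differential Lipschitz constant for the operators `U a_i U†` and `U a_i† U†`. -/
def lipschitz (U O : Op V) : ℝ :=
  √(∑ i : V, (opNorm (comm O (conj U (annihilation i))) ^ 2 +
    opNorm (comm O (conj U (annihilation i).conjTranspose)) ^ 2))

/-- The output vector `|ψ⟩ = U |0⟩^{⊗ V}` of a circuit. -/
def Circuit.output {G : SimpleGraph V} {L : ℕ} (C : Circuit G L) : Bits V → ℂ :=
  C.op.mulVec (ketZero V)

/-- The state `σ(U) = e^{-β_ε H_U} / tr e^{-β_ε H_U}` with `β_ε = log (1 / ε)`. -/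
def sigma (U : Op V) (ε : ℝ) : Op V := gibbs (Real.log ε⁻¹) (hamiltonian U)

end QubitCircuit

end

/-!
Undo the unitary `U` and let `p i` be the probability that `ρ` then excites the qubit `i`. The
thermal state is a product in which every qubit is excited with probability
`q = ε² / (1 + ε²) ≤ ε / 2`, so the Gibbs variational principle, tested on `∑ i, l i * a_i† a_i`,
bounds `∑ i, (l i * p i - log (1 - q + q * exp (l i)))` by the relative entropy `D` for all real
`l`. Taking `l i = log (p i / q)` if `p i > q` and `l i = 0` otherwise, each summand is at least the
square of the positive part of `√(2 * p i) - √(2 * q)`, and Minkowski's inequality gives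
`√(∑ i, 2 * p i) ≤ √(ε n) + √D`.

Conversely, few excitations mean that `ρ` is close to `U|0⟩`. Empty the qubits one after the other
by the channel with Kraus operators `a_i` and `a_i a_i†`. The Heisenberg picture of this channel
moves an observable by commutators with `a_i` and `a_i†`, multiplied by `a_i` on the right or by
`a_i†` on the left, so by the Cauchy–Schwarz inequality its expectation moves by at most
`(‖[O, a_i]‖ + ‖[O, a_i†]‖) * √(p i)`; the other `p j` do not change, because `a_i` commutes with
`a_j† a_j`. Once all qubits are empty the state is `U|0⟩`.
-/

noncomputable section

open scoped ComplexOrder MatrixOrder Matrix.Norms.L2Operator Kronecker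

namespace QubitCircuit

section PositiveFunctional

variable {A : Type*} [CStarAlgebra A] [PartialOrder A] [StarOrderedRing A] {φ : A →ₚ[ℂ] ℂ}

lemma norm_apply_star_mul_le (x y : A) :
    ‖φ (star x * y)‖ ≤ √(φ (star x * x)).re * √(φ (star y * y)).re :=
  norm_inner_le_norm (𝕜 := ℂ) (φ.toPreGNS x) (φ.toPreGNS y)

lemma sqrt_re_apply_star_mul_self_le (hφ : φ 1 = 1) (x : A) :
    √(φ (star x * x)).re ≤ ‖x‖ := by
  have h := φ.norm_apply_le_of_nonneg _ (star_mul_self_nonneg x)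
  rw [hφ, norm_one, one_mul, CStarRing.norm_star_mul_self, ← sq] at h
  exact Real.sqrt_le_iff.mpr ⟨norm_nonneg x, (Complex.re_le_norm _).trans h⟩

lemma norm_apply_star_mul_le_mul_norm (hφ : φ 1 = 1) (x y : A) :
    ‖φ (star x * y)‖ ≤ √(φ (star x * x)).re * ‖y‖ :=
  (norm_apply_star_mul_le x y).trans <| by
    gcongr; exact sqrt_re_apply_star_mul_self_le hφ y

lemma norm_apply_mul_le_norm_mul (hφ : φ 1 = 1) (x y : A) :
    ‖φ (y * x)‖ ≤ ‖y‖ * √(φ (star x * x)).re := by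
  have h := norm_apply_star_mul_le_mul_norm hφ x (star y)
  rwa [← star_mul, map_star, norm_star, norm_star, mul_comm] at h

lemma apply_eq_of_isStarProjection (hφ : φ 1 = 1) {p : A} (hp : IsStarProjection p)
    (h : φ p = 1) {x : A} {c : ℂ} (hx : p * x * p = c • p) : φ x = c := by
  set q : A := 1 - p
  have hq : star q * q = q := by
    rw [hp.one_sub.isSelfAdjoint.star_eq, hp.one_sub.isIdempotentElem.eq]
  have hφq : √(φ (star q * q)).re = 0 := by
    rw [hq, map_sub, hφ, h, sub_self, Complex.zero_re, Real.sqrt_zero]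
  have hleft (y : A) : φ (q * y) = 0 := by
    have := norm_apply_star_mul_le_mul_norm hφ q y
    rwa [hφq, zero_mul, hp.one_sub.isSelfAdjoint.star_eq, norm_le_zero_iff] at this
  have hright (y : A) : φ (y * q) = 0 := by
    simpa [hφq] using norm_apply_mul_le_norm_mul hφ q y
  calc φ x = φ (p * x * p) + φ (q * x) + φ (p * x * q) := by
        rw [← map_add, ← map_add]; congr 1; simp only [q]; noncomm_ring
    _ = c := by rw [hleft, hright, hx, map_smul, h, smul_eq_mul, mul_one, add_zero, add_zero]

end PositiveFunctional

/-- The canonical anticommutation relations of one fermionic mode: `a` is a lowering operator,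
`star a` a raising operator and `star a * a` the occupation number. -/
structure SatisfiesCAR {R : Type*} [Ring R] [StarRing R] (a : R) : Prop where
  sq_eq_zero : a * a = 0
  anticomm : a * star a + star a * a = 1

namespace SatisfiesCAR

section Ring

variable {R S F : Type*} [Ring R] [StarRing R] [Ring S] [StarRing S] {a : R}

lemma map [FunLike F R S] [RingHomClass F R S] [StarHomClass F R S] (ha : SatisfiesCAR a) (f : F) :
    SatisfiesCAR (f a) where
  sq_eq_zero := by rw [← map_mul, ha.sq_eq_zero, map_zero]
  anticomm := by simp only [← map_star, ← map_mul, ← map_add, ha.anticomm, map_one]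

lemma mul_star_mul_self (ha : SatisfiesCAR a) : a * star a * a = a := by
  rw [eq_sub_of_add_eq ha.anticomm, sub_mul, one_mul, mul_assoc, ha.sq_eq_zero, mul_zero, sub_zero]

lemma star_mul_star (ha : SatisfiesCAR a) : star a * star a = 0 := by
  rw [← star_mul, ha.sq_eq_zero, star_zero]

lemma isStarProjection_star_mul_self (ha : SatisfiesCAR a) : IsStarProjection (star a * a) where
  isIdempotentElem := by
    rw [IsIdempotentElem, mul_assoc, ← mul_assoc a, ha.mul_star_mul_self]
  isSelfAdjoint := .star_mul_self a

end Ring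

lemma norm_le_one {A : Type*} [CStarAlgebra A] {a : A} (ha : SatisfiesCAR a) : ‖a‖ ≤ 1 := by
  have h := ha.isStarProjection_star_mul_self.norm_le
  rw [CStarRing.norm_star_mul_self] at h
  nlinarith [norm_nonneg a]

end SatisfiesCAR

section ResetMode

variable {A : Type*} [CStarAlgebra A] [PartialOrder A] [StarOrderedRing A]

/-- The channel emptying the mode `a`, in the Heisenberg picture. Its Kraus operators are `a`, which
lowers an occupied mode, and `a * star a`, the projection onto the empty one. -/
def resetMode (a : A) : A →ₚ[ℂ] A :=
  .mk₀ (LinearMap.mulLeftRight ℂ (a * star a, a * star a) + LinearMap.mulLeftRight ℂ (star a, a))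
    fun x hx => by
      have h := star_left_conjugate_nonneg hx (a * star a)
      rw [star_mul, star_star] at h
      exact add_nonneg h (star_left_conjugate_nonneg hx a)

lemma resetMode_apply (a x : A) :
    resetMode a x = a * star a * x * (a * star a) + star a * x * a := rfl

namespace SatisfiesCAR

variable {a : A}

lemma resetMode_eq_self (ha : SatisfiesCAR a) {x : A} (h : Commute a x) (h' : Commute (star a) x) :
    resetMode a x = x := by
  have hP : a * star a * (a * star a) = a * star a := by
    rw [← mul_assoc, ha.mul_star_mul_self]
  rw [resetMode_apply, (h.mul_left h').eq, mul_assoc x, hP, h'.eq, mul_assoc x, ← mul_add,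
    ha.anticomm, mul_one]

lemma resetMode_star_mul_self (ha : SatisfiesCAR a) : resetMode a (star a * a) = 0 := by
  rw [resetMode_apply]
  linear_combination (norm := noncomm_ring)
    a * ha.star_mul_star * a * a * star a + star a * star a * ha.sq_eq_zero

lemma sub_resetMode (ha : SatisfiesCAR a) (x : A) :
    x - resetMode a x = -(star a * ⁅x, a⁆ + a * ⁅x, star a⁆ * star a * a) := by
  rw [resetMode_apply, Ring.lie_def, Ring.lie_def]
  linear_combination (norm := noncomm_ring)
    a * x * ha.star_mul_star * a - ha.anticomm * x - a * star a * x * ha.anticomm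

lemma norm_apply_sub_apply_resetMode_le (ha : SatisfiesCAR a) {φ : A →ₚ[ℂ] ℂ} (hφ : φ 1 = 1)
    (x : A) :
    ‖φ x - φ (resetMode a x)‖ ≤ (‖⁅x, a⁆‖ + ‖⁅x, star a⁆‖) * √(φ (star a * a)).re := by
  have hnorm : ‖a * ⁅x, star a⁆ * star a‖ ≤ ‖⁅x, star a⁆‖ :=
    calc ‖a * ⁅x, star a⁆ * star a‖ ≤ ‖a‖ * ‖⁅x, star a⁆‖ * ‖star a‖ := norm_mul₃_le
      _ ≤ 1 * ‖⁅x, star a⁆‖ * 1 := by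
        rw [norm_star]; gcongr <;> exact ha.norm_le_one
      _ = ‖⁅x, star a⁆‖ := by ring
  rw [← map_sub, ha.sub_resetMode, map_neg, norm_neg, map_add]
  calc ‖φ (star a * ⁅x, a⁆) + φ (a * ⁅x, star a⁆ * star a * a)‖
      ≤ √(φ (star a * a)).re * ‖⁅x, a⁆‖
          + ‖a * ⁅x, star a⁆ * star a‖ * √(φ (star a * a)).re :=
        norm_add_le_of_le (norm_apply_star_mul_le_mul_norm hφ _ _)
          (norm_apply_mul_le_norm_mul hφ _ _)
    _ ≤ √(φ (star a * a)).re * ‖⁅x, a⁆‖ + ‖⁅x, star a⁆‖ * √(φ (star a * a)).re := by gcongr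
    _ = _ := by ring

end SatisfiesCAR

lemma exists_emptied_modes {ι : Type*} {a : ι → A} (ha : ∀ i, SatisfiesCAR (a i))
    (hcomm : Pairwise fun i j => Commute (a i) (star (a j) * a j))
    {φ : A →ₚ[ℂ] ℂ} (hφ : φ 1 = 1) (s : Finset ι) :
    ∃ φ' : A →ₚ[ℂ] ℂ, φ' 1 = 1 ∧ (∀ i ∈ s, φ' (star (a i) * a i) = 0) ∧
      (∀ i ∉ s, φ' (star (a i) * a i) = φ (star (a i) * a i)) ∧
      ∀ x, ‖φ x - φ' x‖ ≤
        ∑ i ∈ s, (‖⁅x, a i⁆‖ + ‖⁅x, star (a i)⁆‖) * √(φ (star (a i) * a i)).re := by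
  classical
  induction s using Finset.induction_on with
  | empty => exact ⟨φ, hφ, by simp, by simp, by simp⟩
  | insert i s hi ih =>
    obtain ⟨φ', hone, hempty, hrest, hdist⟩ := ih
    have hunchanged {j : ι} (hij : i ≠ j) :
        resetMode (a i) (star (a j) * a j) = star (a j) * a j := by
      refine (ha i).resetMode_eq_self (hcomm hij) ?_
      simpa using (hcomm hij).star_star
    have hcomp (x : A) : φ'.comp (resetMode (a i)) x = φ' (resetMode (a i) x) := rfl
    refine ⟨φ'.comp (resetMode (a i)), ?_, fun j hj => ?_, fun j hj => ?_, fun x => ?_⟩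
    · rw [hcomp, (ha i).resetMode_eq_self (.one_right _) (.one_right _), hone]
    · rw [hcomp]
      obtain rfl | hij := eq_or_ne i j
      · rw [(ha i).resetMode_star_mul_self, map_zero]
      · rw [hunchanged hij, hempty j (Finset.mem_of_mem_insert_of_ne hj hij.symm)]
    · rw [Finset.mem_insert, not_or] at hj
      rw [hcomp, hunchanged (Ne.symm hj.1), hrest j hj.2]
    · rw [Finset.sum_insert hi, add_comm, ← hrest i hi]
      exact (norm_sub_le_norm_sub_add_norm_sub _ (φ' x) _).trans
        (add_le_add (hdist x) ((ha i).norm_apply_sub_apply_resetMode_le hone x))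

end ResetMode

lemma mul_add_le_exp_sub {l : ℝ} (hl : 0 ≤ l) (c h : ℝ) :
    l * h + (l - l * Real.log l - l * c) ≤ Real.exp (h - c) := by
  obtain rfl | hl := hl.eq_or_lt
  · simpa using (Real.exp_pos _).le
  · calc l * h + (l - l * Real.log l - l * c) = l * (h - c - Real.log l + 1) := by ring
      _ ≤ l * Real.exp (h - c - Real.log l) := by gcongr; exact Real.add_one_le_exp _
      _ = Real.exp (h - c) := by rw [Real.exp_sub _ (Real.log l), Real.exp_log hl]; field_simp

lemma smul_add_algebraMap_le_smul_exp {A : Type*} [CStarAlgebra A] [PartialOrder A]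
    [StarOrderedRing A] {H : A} (hH : IsSelfAdjoint H) {l : ℝ} (hl : 0 ≤ l) (c : ℝ) :
    l • H + algebraMap ℝ A (l - l * Real.log l - l * c) ≤
      Real.exp (-c) • NormedSpace.exp H := by
  calc l • H + algebraMap ℝ A (l - l * Real.log l - l * c)
      = cfc (fun h => l * h + (l - l * Real.log l - l * c)) H := by
        rw [cfc_add_const _ _ _, cfc_const_mul _ _ _, cfc_id' ℝ H]
    _ ≤ cfc (fun h => Real.exp (-c) * Real.exp h) H := by
        refine cfc_mono fun h _ => ?_
        rw [← Real.exp_add, neg_add_eq_sub]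
        exact mul_add_le_exp_sub hl c h
    _ = Real.exp (-c) • NormedSpace.exp H := by
        rw [cfc_const_mul _ _ _, CFC.real_exp_eq_normedSpace_exp]

section Matrix

variable {n : Type*} [Fintype n] [DecidableEq n] {ρ H : Matrix n n ℂ}

lemma trace_cfc_mul (hρ : ρ.IsHermitian) (f : ℝ → ℝ) (K : Matrix n n ℂ) :
    (cfc f ρ * K).trace = ∑ k, (f (hρ.eigenvalues k) : ℂ) *
      (star (hρ.eigenvectorUnitary : Matrix n n ℂ) * K * hρ.eigenvectorUnitary) k k := by
  rw [hρ.cfc_eq, Matrix.IsHermitian.cfc, Unitary.conjStarAlgAut_apply, Matrix.mul_assoc,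
    Matrix.trace_mul_cycle, Matrix.trace_mul_comm]
  simp [Matrix.trace, Matrix.diagonal_mul]

lemma trace_exp_pos [Nonempty n] (hH : H.IsHermitian) : 0 < (NormedSpace.exp H).trace := by
  have hnonneg : 0 ≤ NormedSpace.exp H := IsSelfAdjoint.exp_nonneg hH
  exact (Matrix.isStrictlyPositive_iff_posDef.mp
    ((Matrix.isUnit_exp H).isStrictlyPositive hnonneg)).trace_pos

lemma re_conj_diag_le_exp (hH : H.IsHermitian) {u : Matrix n n ℂ} (hu : star u * u = 1) {l : ℝ}
    (hl : 0 ≤ l) (c : ℝ) (k : n) :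
    l * ((star u * H * u) k k).re + (l - l * Real.log l - l * c) ≤
      Real.exp (-c) * ((star u * NormedSpace.exp H * u) k k).re := by
  have h := star_left_conjugate_le_conjugate (smul_add_algebraMap_le_smul_exp hH hl c) u
  simp only [Algebra.algebraMap_eq_smul_one, mul_add, add_mul, mul_smul_comm, smul_mul_assoc,
    mul_one, hu] at h
  have hkk := (Complex.le_def.mp ((Matrix.le_iff.mp h).diag_nonneg (i := k))).1
  simpa only [Matrix.sub_apply, Matrix.add_apply, Matrix.smul_apply, Matrix.one_apply_eq,
    Complex.zero_re, Complex.sub_re, Complex.add_re, Complex.smul_re, Complex.one_re, smul_eq_mul,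
    mul_one, sub_nonneg] using hkk

lemma trace_mul_sub_trace_mul_log_le (hρ : ρ.PosSemidef) (hρ1 : ρ.trace = 1)
    (hH : H.IsHermitian) (c : ℝ) :
    (ρ * H).trace.re - (ρ * cfc Real.log ρ).trace.re + 1 - c ≤
      Real.exp (-c) * (NormedSpace.exp H).trace.re := by
  set u := (hρ.isHermitian.eigenvectorUnitary : Matrix n n ℂ)
  set l := hρ.isHermitian.eigenvalues
  have hu : star u * u = 1 := Unitary.coe_star_mul_self _
  have hlog : ρ * cfc Real.log ρ = cfc (fun x => x * Real.log x) ρ := by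
    rw [cfc_mul _ _ ρ (by fun_prop) (Matrix.finite_real_spectrum.continuousOn _), cfc_id' ℝ ρ]
  have htrace (f : ℝ → ℝ) (K : Matrix n n ℂ) : (cfc f ρ * K).trace.re =
      ∑ k, f (l k) * ((star u * K * u) k k).re := by
    rw [trace_cfc_mul hρ.isHermitian, Complex.re_sum]
    simp only [Complex.re_ofReal_mul, l, u]
  have htrace_one (f : ℝ → ℝ) : (cfc f ρ).trace.re = ∑ k, f (l k) := by
    simpa [hu] using htrace f 1
  have htrace_H : (ρ * H).trace.re = ∑ k, l k * ((star u * H * u) k k).re := by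
    simpa only [cfc_id' ℝ ρ] using htrace (fun x => x) H
  have htrace_ρ : 1 = ∑ k, l k := by
    simpa only [cfc_id' ℝ ρ, hρ1, Complex.one_re] using htrace_one (fun x => x)
  have htrace_exp :
      (NormedSpace.exp H).trace.re = ∑ k, ((star u * NormedSpace.exp H * u) k k).re := by
    simpa only [cfc_const_one ℝ ρ, one_mul] using htrace (fun _ => 1) (NormedSpace.exp H)
  rw [htrace_H, hlog, htrace_one, htrace_exp, Finset.mul_sum]
  calc _ = ∑ k, (l k * ((star u * H * u) k k).re + (l k - l k * Real.log (l k) - l k * c)) := by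
        simp only [Finset.sum_add_distrib, Finset.sum_sub_distrib, ← Finset.sum_mul, ← htrace_ρ]
        ring
    _ ≤ _ := Finset.sum_le_sum fun k _ => re_conj_diag_le_exp hH hu (hρ.eigenvalues_nonneg k) c k

lemma trace_mul_sub_trace_mul_log_le_log_trace_exp [Nonempty n] (hρ : ρ.PosSemidef)
    (hρ1 : ρ.trace = 1) (hH : H.IsHermitian) :
    (ρ * H).trace.re - (ρ * cfc Real.log ρ).trace.re ≤
      Real.log (NormedSpace.exp H).trace.re := by
  have hpos := (Complex.lt_def.mp (trace_exp_pos hH)).1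
  have h := trace_mul_sub_trace_mul_log_le hρ hρ1 hH (Real.log (NormedSpace.exp H).trace.re)
  rw [Real.exp_neg, Real.exp_log hpos, inv_mul_cancel₀ hpos.ne'] at h
  linarith

lemma log_smul_exp (hH : H.IsHermitian) {r : ℝ} (hr : r ≠ 0) :
    cfc Real.log (r • NormedSpace.exp H) = algebraMap ℝ _ (Real.log r) + H := by
  have hspec : ∀ x ∈ spectrum ℝ (NormedSpace.exp H), x ≠ 0 := fun x hx h0 =>
    spectrum.zero_notMem ℝ (Matrix.isUnit_exp H) (h0 ▸ hx)
  have h := CFC.log_smul _ hspec hr hH.isSelfAdjoint.exp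
  rwa [CFC.log_exp H hH] at h

end Matrix

section Gibbs

variable {V : Type*} [Fintype V] [DecidableEq V] {ρ H K : Op V} {β : ℝ}

lemma gibbs_eq_smul_exp (hH : H.IsHermitian) :
    gibbs β H = (NormedSpace.exp (-β • H)).trace.re⁻¹ • NormedSpace.exp (-β • H) := by
  have hsmul : -(β : ℂ) • H = -β • H := by rw [← Complex.ofReal_neg, Complex.coe_smul]
  have hreal : ((NormedSpace.exp (-β • H)).trace.re : ℂ) = (NormedSpace.exp (-β • H)).trace :=
    (Complex.eq_re_of_ofReal_le (trace_exp_pos (IsSelfAdjoint.smul (.all _) hH)).le).symm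
  rw [gibbs, hsmul, ← Complex.coe_smul (_⁻¹ : ℝ), Complex.ofReal_inv, hreal]

lemma relEntropy_gibbs (hρ : ρ.trace = 1) (hH : H.IsHermitian) :
    relEntropy ρ (gibbs β H) = (((ρ * cfc Real.log ρ).trace.re + β * (ρ * H).trace.re +
      Real.log (NormedSpace.exp (-β • H)).trace.re : ℝ) : EReal) := by
  have hH' : (-β • H).IsHermitian := IsSelfAdjoint.smul (.all _) hH
  have hZ : (NormedSpace.exp (-β • H)).trace.re⁻¹ ≠ 0 :=
    inv_ne_zero (Complex.lt_def.mp (trace_exp_pos hH')).1.ne'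
  have hsupp (v : Bits V → ℂ) (hv : (gibbs β H).mulVec v = 0) : ρ.mulVec v = 0 := by
    rw [gibbs_eq_smul_exp hH, Matrix.smul_mulVec, smul_eq_zero_iff_right hZ] at hv
    rw [Matrix.mulVec_injective_of_isUnit (Matrix.isUnit_exp _)
      (hv.trans (Matrix.mulVec_zero _).symm), Matrix.mulVec_zero]
  rw [relEntropy, if_pos hsupp, gibbs_eq_smul_exp hH, log_smul_exp hH' hZ, Real.log_inv]
  congr 1
  simp only [mul_sub, mul_add, Algebra.algebraMap_eq_smul_one, mul_smul_comm, mul_one,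
    Matrix.trace_sub, Matrix.trace_add, Matrix.trace_smul, hρ, Complex.sub_re, Complex.add_re,
    Complex.smul_re, Complex.one_re, smul_eq_mul]
  ring

lemma re_trace_mul_le_relEntropy_add (hρ : IsState ρ) (hH : H.IsHermitian) (hK : K.IsHermitian) :
    (ρ * K).trace.re ≤ (relEntropy ρ (gibbs β H)).toReal +
      Real.log (NormedSpace.exp (-β • H + K)).trace.re -
      Real.log (NormedSpace.exp (-β • H)).trace.re := by
  have h := trace_mul_sub_trace_mul_log_le_log_trace_exp hρ.1 hρ.2 (H := -β • H + K)
    (.add (IsSelfAdjoint.smul (.all _) hH) hK)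
  rw [relEntropy_gibbs hρ.2 hH, EReal.toReal_coe]
  simp only [Matrix.mul_add, Matrix.mul_smul, Matrix.trace_add, Matrix.trace_smul, Complex.add_re,
    Complex.smul_re, smul_eq_mul] at h
  linarith

end Gibbs

section Ampliation

variable {R l m n : Type*} [CommSemiring R] [StarRing R] [Fintype l] [DecidableEq l] [Fintype m]
  [DecidableEq m] [Fintype n] [DecidableEq n]

/-- The embedding `A ↦ A ⊗ I` of the operators of a subsystem `m` into those of the whole system
`l`, along an identification `e` of the basis of the whole with that of the two parts. -/
def ampliation (e : l ≃ m × n) : Matrix m m R →⋆ₐ[R] Matrix l l R where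
  toFun A := (A ⊗ₖ (1 : Matrix n n R)).submatrix e e
  map_one' := by rw [Matrix.one_kronecker_one, Matrix.submatrix_one_equiv]
  map_mul' A B := by
    rw [Matrix.submatrix_mul_equiv, ← Matrix.mul_kronecker_mul, one_mul]
  map_zero' := by rw [Matrix.zero_kronecker, Matrix.submatrix_zero]; rfl
  map_add' A B := by rw [Matrix.add_kronecker, Matrix.submatrix_add]; rfl
  commutes' r := by
    simp only [Algebra.algebraMap_eq_smul_one, Matrix.smul_kronecker, Matrix.one_kronecker_one,
      Matrix.submatrix_smul, Pi.smul_apply, Matrix.submatrix_one_equiv]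
  map_star' A := by
    simp only [Matrix.star_eq_conjTranspose, Matrix.conjTranspose_submatrix,
      Matrix.conjTranspose_kronecker, Matrix.conjTranspose_one]

lemma ampliation_apply (e : l ≃ m × n) (A : Matrix m m R) (x y : l) :
    ampliation e A x y = if (e x).2 = (e y).2 then A (e x).1 (e y).1 else 0 := by
  change A _ _ * (1 : Matrix n n R) _ _ = _
  rw [Matrix.one_apply, mul_ite, mul_one, mul_zero]

end Ampliation

section OnSite

variable {V : Type*} [Fintype V] [DecidableEq V]

lemma extend_eq_ampliation (s : Finset V) (A : Matrix (s → Fin 2) (s → Fin 2) ℂ) :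
    extend s A = ampliation (Equiv.piEquivPiSubtypeProd (· ∈ s) fun _ => Fin 2) A := by
  ext x y
  simp only [ampliation_apply, extend, Matrix.of_apply, Equiv.piEquivPiSubtypeProd_apply,
    funext_iff, Subtype.forall]

lemma onSite_eq_ampliation (i : V) (A : Matrix (Fin 2) (Fin 2) ℂ) :
    onSite i A = ampliation (Equiv.funSplitAt i (Fin 2)) A := by
  ext x y
  simp only [ampliation_apply, onSite, Matrix.of_apply, Equiv.funSplitAt_apply,
    funext_iff, Subtype.forall]

lemma Circuit.op_mem_unitaryGroup {G : SimpleGraph V} {L : ℕ} (C : Circuit G L) :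
    C.op ∈ Matrix.unitaryGroup (Bits V) ℂ := by
  refine Submonoid.list_prod_mem _ fun A hA => ?_
  obtain ⟨l, rfl⟩ := (List.mem_ofFn' _ _).mp hA
  refine Submonoid.list_prod_mem _ fun B hB => ?_
  obtain ⟨g, -, rfl⟩ := List.mem_map.mp hB
  rw [extend_eq_ampliation]
  exact Unitary.map_mem _ g.unitary.2

lemma onSite_diagonal (i : V) (d : Fin 2 → ℂ) :
    onSite i (Matrix.diagonal d) = Matrix.diagonal fun x => d (x i) := by
  ext x y
  obtain rfl | hxy := eq_or_ne x y
  · simp [onSite]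
  · rw [Matrix.diagonal_apply_ne _ hxy, onSite, Matrix.of_apply, ite_eq_right_iff]
    intro hoff
    refine Matrix.diagonal_apply_ne _ fun hi => hxy (funext fun j => ?_)
    obtain rfl | hj := eq_or_ne j i
    exacts [hi, hoff j hj]

lemma satisfiesCAR_annihilation (i : V) : SatisfiesCAR (annihilation i) := by
  have hqubit : SatisfiesCAR !![(0 : ℂ), 1; 0, 0] := by
    constructor <;> ext a b <;> fin_cases a <;> fin_cases b <;>
      simp only [Matrix.add_apply, Matrix.mul_apply, Matrix.star_apply, Fin.sum_univ_two] <;> simp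
  rw [annihilation, onSite_eq_ampliation]
  exact hqubit.map _

lemma star_annihilation_mul_annihilation (i : V) :
    star (annihilation i) * annihilation i = onSite i (Matrix.diagonal ![0, 1]) := by
  simp only [annihilation, onSite_eq_ampliation, ← map_star, ← map_mul]
  congr 1
  ext a b
  fin_cases a <;> fin_cases b <;> simp [Matrix.mul_apply, Matrix.star_apply, Fin.sum_univ_two]

lemma commute_annihilation_star_mul_self {i j : V} (hij : i ≠ j) :
    Commute (annihilation i) (star (annihilation j) * annihilation j) := by
  rw [star_annihilation_mul_annihilation, onSite_diagonal, annihilation]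
  ext x y
  rw [Matrix.mul_diagonal, Matrix.diagonal_mul, onSite, Matrix.of_apply]
  split_ifs with hoff
  · rw [hoff j hij.symm, mul_comm]
  · rw [zero_mul, mul_zero]

lemma sum_onSite_diagonal (d : V → Fin 2 → ℂ) :
    ∑ i, onSite i (Matrix.diagonal (d i)) = Matrix.diagonal fun x => ∑ i, d i (x i) := by
  simp only [onSite_diagonal]
  rw [← Finset.sum_fn]
  exact (map_sum (Matrix.diagonalAddMonoidHom (Bits V) ℂ) (fun i x => d i (x i)) _).symm

end OnSite

section Expectation

variable {n : Type*} [Fintype n] {ρ : Matrix n n ℂ}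

lemma trace_mul_nonneg {X : Matrix n n ℂ} (hρ : ρ.PosSemidef) (hX : X.PosSemidef) :
    0 ≤ (ρ * X).trace := by
  classical
  obtain ⟨B, rfl⟩ := CStarAlgebra.nonneg_iff_eq_star_mul_self.mp hρ.nonneg
  rw [Matrix.mul_assoc, Matrix.trace_mul_comm]
  exact (hX.mul_mul_conjTranspose_same B).trace_nonneg

variable [DecidableEq n]

/-- The positive functional `X ↦ tr (ρ X)` on a matrix algebra, a state when `tr ρ = 1`. -/
def expectation (hρ : ρ.PosSemidef) : Matrix n n ℂ →ₚ[ℂ] ℂ :=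
  .mk₀ (Matrix.traceLinearMap n ℂ ℂ ∘ₗ LinearMap.mulLeft ℂ ρ) fun _ hX =>
    trace_mul_nonneg hρ (Matrix.nonneg_iff_posSemidef.mp hX)

lemma expectation_apply (hρ : ρ.PosSemidef) (X : Matrix n n ℂ) :
    expectation hρ X = (ρ * X).trace := rfl

end Expectation

section Ket

variable {V : Type*} [Fintype V]

lemma ketbra_ketZero : ketbra (ketZero V) = Matrix.diagonal (Pi.single 0 1) := by
  rw [ketbra, ketZero, ← Pi.single_star, star_one, ← Matrix.single_eq_single_vecMulVec_single,
    Matrix.diagonal_single]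

variable [DecidableEq V]

lemma isStarProjection_ketbra {ψ : Bits V → ℂ} (hψ : star ψ ⬝ᵥ ψ = 1) :
    IsStarProjection (ketbra ψ) where
  isIdempotentElem := by
    rw [IsIdempotentElem, ketbra, Matrix.vecMulVec_mul_vecMulVec, hψ, one_smul]
  isSelfAdjoint := by
    rw [IsSelfAdjoint, ketbra, Matrix.star_eq_conjTranspose, Matrix.conjTranspose_vecMulVec,
      star_star]

lemma ketbra_mul_mul_ketbra (ψ : Bits V → ℂ) (A : Op V) :
    ketbra ψ * A * ketbra ψ = (A * ketbra ψ).trace • ketbra ψ := by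
  rw [Matrix.mul_assoc, ketbra, Matrix.mul_vecMulVec, Matrix.vecMulVec_mul_vecMulVec,
    Matrix.trace_vecMulVec, Matrix.vecMulVec_smul, dotProduct_comm]

lemma ketbra_mulVec (U : Op V) (ψ : Bits V → ℂ) : ketbra (U.mulVec ψ) = conj U (ketbra ψ) := by
  rw [conj, ketbra, ketbra, Matrix.star_mulVec, Matrix.mul_vecMulVec, Matrix.vecMulVec_mul]

lemma one_sub_ketbra_ketZero_le :
    1 - ketbra (ketZero V) ≤ ∑ i : V, star (annihilation i) * annihilation i := by
  simp only [star_annihilation_mul_annihilation, sum_onSite_diagonal]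
  rw [ketbra_ketZero, ← Matrix.diagonal_one, Matrix.diagonal_sub, Matrix.le_iff,
    Matrix.diagonal_sub, Matrix.posSemidef_diagonal_iff]
  intro x
  have hbit (b : Fin 2) : 0 ≤ (![0, 1] b : ℂ) := by fin_cases b <;> simp
  rw [sub_nonneg]
  obtain rfl | hx := eq_or_ne x 0
  · rw [Pi.single_eq_same, sub_self]
    exact Finset.sum_nonneg fun i _ => hbit _
  · obtain ⟨i, hi⟩ := Function.ne_iff.mp hx
    have hi1 : x i = 1 := Fin.eq_one_of_ne_zero _ hi
    calc 1 - (Pi.single 0 1 : Bits V → ℂ) x = ![0, 1] (x i) := by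
          rw [Pi.single_eq_of_ne hx, sub_zero, hi1, Matrix.cons_val_one, Matrix.cons_val_fin_one]
      _ ≤ ∑ j, ![0, 1] (x j) :=
          Finset.single_le_sum (f := fun j => (![0, 1] (x j) : ℂ)) (fun j _ => hbit _)
            (Finset.mem_univ i)

lemma apply_eq_trace_mul_ketbra_ketZero {φ : Op V →ₚ[ℂ] ℂ} (hφ : φ 1 = 1)
    (hempty : ∀ i, φ (star (annihilation i) * annihilation i) = 0) (X : Op V) :
    φ X = (X * ketbra (ketZero V)).trace := by
  have hp : IsStarProjection (ketbra (ketZero V)) := isStarProjection_ketbra (by simp [ketZero])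
  have hle : φ (1 - ketbra (ketZero V)) ≤ 0 := by
    simpa only [map_sum, hempty, Finset.sum_const_zero] using
      OrderHomClass.mono φ (one_sub_ketbra_ketZero_le (V := V))
  have hvac : φ (ketbra (ketZero V)) = 1 := by
    have h := le_antisymm hle (map_nonneg φ hp.one_sub.nonneg)
    rw [map_sub, hφ, sub_eq_zero] at h
    exact h.symm
  exact apply_eq_of_isStarProjection hφ hp hvac (ketbra_mul_mul_ketbra _ X)

lemma norm_apply_sub_trace_mul_ketbra_ketZero_le {φ : Op V →ₚ[ℂ] ℂ} (hφ : φ 1 = 1) (X : Op V) :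
    ‖φ X - (X * ketbra (ketZero V)).trace‖ ≤
      ∑ i : V, (‖⁅X, annihilation i⁆‖ + ‖⁅X, star (annihilation i)⁆‖) *
        √(φ (star (annihilation i) * annihilation i)).re := by
  obtain ⟨φ', hone, hempty, -, hdist⟩ := exists_emptied_modes satisfiesCAR_annihilation
    (fun _ _ => commute_annihilation_star_mul_self) hφ (Finset.univ : Finset V)
  rw [← apply_eq_trace_mul_ketbra_ketZero hone fun i => hempty i (Finset.mem_univ i)]
  exact hdist X

end Ket

section Conjugation

variable {V : Type*} [Fintype V] [DecidableEq V]

lemma lipschitz_conj (U : Matrix.unitaryGroup (Bits V) ℂ) (X : Op V) :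
    lipschitz U (conj U X) =
      √(∑ i : V, (‖⁅X, annihilation i⁆‖ ^ 2 + ‖⁅X, star (annihilation i)⁆‖ ^ 2)) := by
  have hcomm (A : Op V) : opNorm (comm (conj U X) (conj U A)) = ‖⁅X, A⁆‖ := by
    let F := Unitary.conjStarAlgAut ℂ (Op V) U
    calc opNorm (comm (conj U X) (conj U A)) = ‖F X * F A - F A * F X‖ := rfl
      _ = ‖F ⁅X, A⁆‖ := by rw [Ring.lie_def, map_sub, map_mul, map_mul]
      _ = ‖⁅X, A⁆‖ := StarAlgEquiv.norm_map F _
  simp only [lipschitz, hcomm, Matrix.star_eq_conjTranspose]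

lemma trace_mul_conj (U A B : Op V) :
    (A * conj U B).trace = (U.conjTranspose * A * U * B).trace := by
  rw [conj, ← Matrix.mul_assoc, Matrix.trace_mul_comm]
  simp only [Matrix.mul_assoc]

lemma conj_add (U A B : Op V) : conj U (A + B) = conj U A + conj U B := by
  rw [conj, mul_add, add_mul, conj, conj]

lemma conj_mul_conj (U : Matrix.unitaryGroup (Bits V) ℂ) (A B : Op V) :
    conj U A * conj U B = conj U (A * B) :=
  (map_mul (Unitary.conjStarAlgAut ℂ (Op V) U) A B).symm

lemma trace_conj (U : Matrix.unitaryGroup (Bits V) ℂ) (A : Op V) :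
    (conj U A).trace = A.trace := by
  rw [conj, Matrix.trace_mul_cycle, ← Matrix.star_eq_conjTranspose,
    Unitary.coe_star_mul_self, one_mul]

lemma trace_exp_conj (U : Matrix.unitaryGroup (Bits V) ℂ) (A : Op V) :
    (NormedSpace.exp (conj U A)).trace = (NormedSpace.exp A).trace := by
  have hexp : NormedSpace.exp (conj U A) = conj U (NormedSpace.exp A) :=
    Matrix.exp_units_conj (Unitary.toUnits U) A
  rw [hexp, trace_conj]

lemma trace_exp_sum_onSite_diagonal (d : V → Fin 2 → ℝ) :
    (NormedSpace.exp (∑ i, onSite i (Matrix.diagonal fun b => (d i b : ℂ)))).trace =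
      ((∏ i, ∑ b, Real.exp (d i b) : ℝ) : ℂ) := by
  rw [sum_onSite_diagonal, Matrix.exp_diagonal, Matrix.trace_diagonal, Fintype.prod_sum]
  push_cast
  refine Finset.sum_congr rfl fun x _ => ?_
  rw [Pi.coe_exp, ← Complex.exp_eq_exp_ℂ, Complex.exp_sum]

end Conjugation

section Scalar

lemma sub_one_mul_le_two_mul_sq_mul_log {t : ℝ} (ht : 1 ≤ t) :
    (t - 1) * (3 * t - 1) ≤ 2 * t ^ 2 * Real.log t := by
  have h := Real.le_log_one_add_of_nonneg (sub_nonneg.mpr ht)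
  rw [add_sub_cancel] at h
  refine le_trans ?_ (mul_le_mul_of_nonneg_left h (by positivity))
  rw [mul_div_assoc', le_div_iff₀ (by linarith)]
  nlinarith [mul_nonneg (sub_nonneg.mpr ht) (sq_nonneg (t - 1))]

lemma two_mul_sq_sqrt_sub_sqrt_le {p q : ℝ} (hq : 0 < q) (hpq : q ≤ p) :
    2 * (√p - √q) ^ 2 ≤ p * Real.log (p / q) - (p - q) := by
  have ht : 1 ≤ √(p / q) := Real.one_le_sqrt.mpr ((one_le_div hq).mpr hpq)
  set t := √(p / q)
  have htq : t ^ 2 = p / q := Real.sq_sqrt (div_nonneg (hq.le.trans hpq) hq.le)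
  have hp : p = q * t ^ 2 := by rw [htq, mul_div_cancel₀ _ hq.ne']
  have hsqrt : √p = √q * t := by rw [hp, Real.sqrt_mul hq.le, Real.sqrt_sq (by linarith)]
  have hlog : Real.log (p / q) = 2 * Real.log t := by rw [← htq, Real.log_pow, Nat.cast_ofNat]
  calc 2 * (√p - √q) ^ 2 = q * ((t - 1) * (3 * t - 1) - t ^ 2 + 1) := by
        linear_combination 2 * (√p + √q * t - 2 * √q) * hsqrt + 2 * (t - 1) ^ 2 * Real.sq_sqrt hq.le
    _ ≤ q * (2 * t ^ 2 * Real.log t - t ^ 2 + 1) := by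
        gcongr q * (?_ - t ^ 2 + 1)
        exact sub_one_mul_le_two_mul_sq_mul_log ht
    _ = p * Real.log (p / q) - (p - q) := by rw [hlog, hp]; ring

lemma exists_sqrt_two_mul_le_sqrt_add_sqrt {p q : ℝ} (hq : 0 < q) :
    ∃ l : ℝ, 0 ≤ l * p - Real.log (1 - q + q * Real.exp l) ∧
      √(2 * p) ≤ √(2 * q) + √(l * p - Real.log (1 - q + q * Real.exp l)) := by
  obtain hpq | hqp := le_or_gt p q
  · refine ⟨0, by simp, (Real.sqrt_le_sqrt ?_).trans (le_add_of_nonneg_right (Real.sqrt_nonneg _))⟩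
    gcongr
  · -- `p / q` replaces the optimal odds ratio `p * (1 - q) / (q * (1 - p))`, infinite at `p = 1`
    refine ⟨Real.log (p / q), ?_⟩
    have hexp : 1 - q + q * Real.exp (Real.log (p / q)) = 1 + (p - q) := by
      rw [Real.exp_log (div_pos (hq.trans hqp) hq), mul_div_cancel₀ _ hq.ne']
      ring
    have hlog : Real.log (1 + (p - q)) ≤ p - q := by
      simpa using Real.log_le_sub_one_of_pos (x := 1 + (p - q)) (by linarith)
    have hdiv : (√(2 * p) - √(2 * q)) ^ 2 ≤
        Real.log (p / q) * p - Real.log (1 - q + q * Real.exp (Real.log (p / q))) := by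
      rw [Real.sqrt_mul zero_le_two, Real.sqrt_mul zero_le_two, ← mul_sub, mul_pow,
        Real.sq_sqrt zero_le_two, hexp, mul_comm (Real.log _)]
      exact (two_mul_sq_sqrt_sub_sqrt_le hq hqp.le).trans (by gcongr)
    exact ⟨(sq_nonneg _).trans hdiv, sub_le_iff_le_add'.mp (Real.le_sqrt_of_sq_le hdiv)⟩

variable {ι : Type*} {s : Finset ι} {f g h : ι → ℝ}

lemma sqrt_sum_le_sqrt_sum_add_sqrt_sum (hg : ∀ i, 0 ≤ g i) (hh : ∀ i, 0 ≤ h i)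
    (hle : ∀ i ∈ s, √(f i) ≤ √(g i) + √(h i)) :
    √(∑ i ∈ s, f i) ≤ √(∑ i ∈ s, g i) + √(∑ i ∈ s, h i) := by
  rw [Real.sqrt_le_left (by positivity)]
  calc ∑ i ∈ s, f i ≤ ∑ i ∈ s, (√(g i) + √(h i)) ^ 2 :=
        Finset.sum_le_sum fun i hi => (Real.sqrt_le_left (by positivity)).mp (hle i hi)
    _ = ∑ i ∈ s, g i + 2 * ∑ i ∈ s, √(g i) * √(h i) + ∑ i ∈ s, h i := by
        simp only [add_sq, Real.sq_sqrt (hg _), Real.sq_sqrt (hh _), Finset.sum_add_distrib,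
          mul_assoc, Finset.mul_sum]
    _ ≤ ∑ i ∈ s, g i + 2 * (√(∑ i ∈ s, g i) * √(∑ i ∈ s, h i)) + ∑ i ∈ s, h i := by
        gcongr
        exact Real.sum_sqrt_mul_sqrt_le s hg hh
    _ = (√(∑ i ∈ s, g i) + √(∑ i ∈ s, h i)) ^ 2 := by
        rw [add_sq, Real.sq_sqrt (Finset.sum_nonneg fun i _ => hg i),
          Real.sq_sqrt (Finset.sum_nonneg fun i _ => hh i), mul_assoc]

lemma sum_add_mul_sqrt_le (hf : ∀ i ∈ s, 0 ≤ f i) :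
    ∑ i ∈ s, (g i + h i) * √(f i) ≤ √(∑ i ∈ s, (g i ^ 2 + h i ^ 2)) * √(∑ i ∈ s, 2 * f i) := by
  calc ∑ i ∈ s, (g i + h i) * √(f i)
      ≤ √(∑ i ∈ s, (g i + h i) ^ 2) * √(∑ i ∈ s, √(f i) ^ 2) :=
        Real.sum_mul_le_sqrt_mul_sqrt s _ _
    _ ≤ √(∑ i ∈ s, 2 * (g i ^ 2 + h i ^ 2)) * √(∑ i ∈ s, f i) := by
        gcongr with i _ i hi
        · exact add_sq_le
        · exact (Real.sq_sqrt (hf i hi)).le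
    _ = _ := by
        rw [← Finset.mul_sum, ← Finset.mul_sum, Real.sqrt_mul zero_le_two,
          Real.sqrt_mul zero_le_two]
        ring

end Scalar

section Thermal

variable {V : Type*} [Fintype V] [DecidableEq V] {ρ : Op V} {ε : ℝ}

lemma pauliZ_eq_onSite_diagonal (i : V) : pauliZ i = onSite i (Matrix.diagonal ![1, -1]) := by
  rw [pauliZ]
  congr 1
  ext a b
  fin_cases a <;> fin_cases b <;> rfl

lemma smul_pauliZ_add_smul_star_mul_self (i : V) (β l : ℝ) :
    β • pauliZ i + l • (star (annihilation i) * annihilation i) =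
      onSite i (Matrix.diagonal fun b => (((![β, l - β] : Fin 2 → ℝ) b : ℝ) : ℂ)) := by
  rw [pauliZ_eq_onSite_diagonal, star_annihilation_mul_annihilation, onSite_diagonal,
    onSite_diagonal, onSite_diagonal, ← Matrix.diagonal_smul, ← Matrix.diagonal_smul,
    Matrix.diagonal_add]
  congr 1
  ext x
  obtain hx | hx : x i = 0 ∨ x i = 1 := by omega
  all_goals simp [hx, sub_eq_neg_add]

lemma isHermitian_hamiltonian (U : Op V) : (hamiltonian U).IsHermitian := by
  refine Matrix.IsHermitian.neg (isSelfAdjoint_sum _ fun i _ => ?_)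
  refine Matrix.isHermitian_mul_mul_conjTranspose U ?_
  rw [pauliZ_eq_onSite_diagonal, onSite_diagonal, Matrix.isHermitian_diagonal_iff]
  intro x
  generalize x i = b
  fin_cases b <;> simp [IsSelfAdjoint]

lemma trace_exp_smul_hamiltonian_add (U : Matrix.unitaryGroup (Bits V) ℂ) (β : ℝ) (l : V → ℝ) :
    (NormedSpace.exp (-β • hamiltonian U +
      conj U (∑ i, l i • (star (annihilation i) * annihilation i)))).trace.re =
        ∏ i, (Real.exp β + Real.exp (l i - β)) := by
  have hham : -β • hamiltonian (U : Op V) = conj U (∑ i, β • pauliZ i) := by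
    rw [hamiltonian, neg_smul_neg, Finset.smul_sum]
    simp only [conj, Matrix.mul_sum, Matrix.sum_mul, Matrix.mul_smul, Matrix.smul_mul]
  rw [hham, ← conj_add, trace_exp_conj, ← Finset.sum_add_distrib]
  simp only [smul_pauliZ_add_smul_star_mul_self, trace_exp_sum_onSite_diagonal,
    Complex.ofReal_re, Fin.sum_univ_two, Matrix.cons_val_zero, Matrix.cons_val_one,
    Matrix.cons_val_fin_one]

/-- The probability that qubit `i` is found in `|1⟩` when `U` is undone on the state `ρ`. -/
def excitation (U ρ : Op V) (i : V) : ℝ :=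
  (ρ * conj U (star (annihilation i) * annihilation i)).trace.re

/-- The excitation probability `e^{-β} / (e^β + e^{-β})` of each qubit in the thermal state
`sigma U ε`, where `e^β = ε⁻¹`. -/
def thermalExcitation (ε : ℝ) : ℝ := ε ^ 2 / (1 + ε ^ 2)

lemma thermalExcitation_pos (hε : 0 < ε) : 0 < thermalExcitation ε := by
  rw [thermalExcitation]
  positivity

lemma two_mul_thermalExcitation_le (hε : 0 < ε) : 2 * thermalExcitation ε ≤ ε := by
  rw [thermalExcitation, mul_div_assoc', div_le_iff₀ (by positivity)]
  nlinarith [mul_nonneg hε.le (sq_nonneg (1 - ε))]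

lemma log_exp_add_exp_sub_sub_log (hε : 0 < ε) (l : ℝ) :
    Real.log (Real.exp (Real.log ε⁻¹) + Real.exp (l - Real.log ε⁻¹)) -
      Real.log (Real.exp (Real.log ε⁻¹) + Real.exp (-Real.log ε⁻¹)) =
        Real.log (1 - thermalExcitation ε + thermalExcitation ε * Real.exp l) := by
  rw [← Real.log_div (by positivity) (by positivity), Real.exp_sub, Real.exp_neg,
    Real.exp_log (inv_pos.mpr hε), thermalExcitation]
  congr 1
  field_simp
  ring

lemma sum_mul_excitation_sub_log_le (hρ : IsState ρ) (U : Matrix.unitaryGroup (Bits V) ℂ)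
    (hε : 0 < ε) (l : V → ℝ) :
    ∑ i, (l i * excitation U ρ i -
        Real.log (1 - thermalExcitation ε + thermalExcitation ε * Real.exp (l i))) ≤
      (relEntropy ρ (sigma U ε)).toReal := by
  set β := Real.log ε⁻¹ with hβ
  let K : Op V := ∑ i, l i • (star (annihilation i) * annihilation i)
  have hK : (conj U K).IsHermitian := Matrix.isHermitian_mul_mul_conjTranspose _ <|
    isSelfAdjoint_sum _ fun i _ => .smul (.all _) (.star_mul_self _)
  have hmean : (ρ * conj U K).trace.re = ∑ i, l i * excitation U ρ i := by
    simp only [K, excitation, conj, Matrix.mul_sum, Matrix.sum_mul, Matrix.trace_sum,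
      Matrix.mul_smul, Matrix.smul_mul, Matrix.trace_smul, Complex.re_sum, Complex.smul_re,
      smul_eq_mul]
  have hZ : (NormedSpace.exp (-β • hamiltonian (U : Op V))).trace.re =
      ∏ _i : V, (Real.exp β + Real.exp (-β)) := by
    simpa [conj] using trace_exp_smul_hamiltonian_add U β 0
  have h := re_trace_mul_le_relEntropy_add (β := β) hρ (isHermitian_hamiltonian (U : Op V)) hK
  rw [hmean, hZ, trace_exp_smul_hamiltonian_add, Real.log_prod fun _ _ => by positivity,
    Real.log_prod fun _ _ => by positivity, add_sub_assoc, ← Finset.sum_sub_distrib] at h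
  simp only [hβ, log_exp_add_exp_sub_sub_log hε] at h
  rw [Finset.sum_sub_distrib]
  exact sub_le_iff_le_add.mpr h

lemma sqrt_sum_two_mul_excitation_le (hρ : IsState ρ) (U : Matrix.unitaryGroup (Bits V) ℂ)
    (hε : 0 < ε) :
    √(∑ i, 2 * excitation U ρ i) ≤
      √(ε * Fintype.card V) + √(relEntropy ρ (sigma U ε)).toReal := by
  have hq := thermalExcitation_pos hε
  choose l hl hsqrt using fun i =>
    exists_sqrt_two_mul_le_sqrt_add_sqrt (p := excitation U ρ i) hq
  calc √(∑ i, 2 * excitation U ρ i)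
      ≤ √(∑ _i : V, 2 * thermalExcitation ε) + √(∑ i, (l i * excitation U ρ i -
          Real.log (1 - thermalExcitation ε + thermalExcitation ε * Real.exp (l i)))) :=
        sqrt_sum_le_sqrt_sum_add_sqrt_sum (fun _ => by positivity) hl fun i _ => hsqrt i
    _ ≤ √(ε * Fintype.card V) + √(relEntropy ρ (sigma U ε)).toReal := by
        rw [Finset.sum_const, nsmul_eq_mul, mul_comm _ (2 * _), Finset.card_univ]
        gcongr
        · exact two_mul_thermalExcitation_le hε
        · exact sum_mul_excitation_sub_log_le hρ U hε l

lemma relEntropy_sigma_ne_top (hρ : ρ.trace = 1) (U : Op V) (ε : ℝ) :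
    relEntropy ρ (sigma U ε) ≠ ⊤ := by
  rw [sigma, relEntropy_gibbs hρ (isHermitian_hamiltonian U)]
  exact EReal.coe_ne_top _

lemma norm_trace_mul_ketbra_sub_le (hρ : IsState ρ) (U : Matrix.unitaryGroup (Bits V) ℂ)
    (O : Op V) :
    ‖(O * (ketbra ((U : Op V).mulVec (ketZero V)) - ρ)).trace‖ ≤
      lipschitz U O * √(∑ i, 2 * excitation U ρ i) := by
  let φ := expectation (hρ.1.conjTranspose_mul_mul_same (U : Op V))
  have hφ (X : Op V) : φ X = (ρ * conj U X).trace := by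
    rw [expectation_apply, trace_mul_conj]
  have hone : φ 1 = 1 := by
    rw [expectation_apply, mul_one, Matrix.trace_mul_cycle, ← Matrix.star_eq_conjTranspose,
      Unitary.mul_star_self_of_mem U.2, one_mul, hρ.2]
  have hexcitation (i : V) :
      (φ (star (annihilation i) * annihilation i)).re = excitation U ρ i := by
    rw [hφ, excitation]
  obtain ⟨X, rfl⟩ : ∃ X, conj U X = O := (Unitary.conjStarAlgAut ℂ (Op V) U).surjective O
  have htrace : (conj U X * (ketbra ((U : Op V).mulVec (ketZero V)) - ρ)).trace =
      (X * ketbra (ketZero V)).trace - φ X := by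
    rw [ketbra_mulVec, mul_sub, Matrix.trace_sub, conj_mul_conj, trace_conj, hφ,
      Matrix.trace_mul_comm _ ρ]
  rw [htrace, norm_sub_rev, lipschitz_conj]
  refine (norm_apply_sub_trace_mul_ketbra_ketZero_le hone X).trans ?_
  simp only [hexcitation]
  refine sum_add_mul_sqrt_le fun i _ => ?_
  rw [← hexcitation]
  exact (Complex.le_def.mp (map_nonneg φ (star_mul_self_nonneg _))).1

end Thermal

end QubitCircuit

end

open QubitCircuit in
theorem mainTheorem5_general {V : Type*} [Fintype V] [DecidableEq V]
    (U : Matrix.unitaryGroup (Bits V) ℂ) {ε : ℝ} (hε : 0 < ε) {ρ : Op V} (hρ : IsState ρ)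
    (O : Op V) :
    relEntropy ρ (sigma U ε) ≠ ⊤ ∧
      ‖(O * (ketbra ((U : Op V).mulVec (ketZero V)) - ρ)).trace‖ ≤
        lipschitz U O *
          (√(ε * (Fintype.card V : ℝ)) + √(relEntropy ρ (sigma U ε)).toReal) :=
  ⟨relEntropy_sigma_ne_top hρ.2 U ε, (norm_trace_mul_ketbra_sub_le hρ U O).trans <|
    mul_le_mul_of_nonneg_left (sqrt_sum_two_mul_excitation_le hρ U hε) (Real.sqrt_nonneg _)⟩

theorem mainTheorem5 {V : Type*} [Fintype V] [DecidableEq V] (G : SimpleGraph V) (L : ℕ)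
    (C : QubitCircuit.Circuit G L) (ε : ℝ) (hε : 0 < ε)
    (ρ : QubitCircuit.Op V) (hρ : QubitCircuit.IsState ρ)
    (O : QubitCircuit.Op V) (hO : O.IsHermitian) :
    QubitCircuit.relEntropy ρ (QubitCircuit.sigma C.op ε) ≠ ⊤ ∧
      ‖(O * (QubitCircuit.ketbra C.output - ρ)).trace‖ ≤
        QubitCircuit.lipschitz C.op O *
          (√(ε * (Fintype.card V : ℝ)) +
            √(QubitCircuit.relEntropy ρ (QubitCircuit.sigma C.op ε)).toReal) :=
  mainTheorem5_general ⟨C.op, C.op_mem_unitaryGroup⟩ hε hρ O
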